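/- Let $M$ be a finite-dimensional, Hausdorff, second countable real $C^\infty$ manifold (without boundary), let $\Omega$ be a presymplectic form on $M$ (a closed smooth 2-form of constant rank), and let $G$ be a finite-dimensional real Lie group with Lie algebra $\mathfrak g$ and a smooth action $\Phi$ on $M$. For $\xi\in\mathfrak g$ let $\tilde\xi$ be the fundamental vector field of $\xi$ on $M$, and put $\tilde{\mathfrak g}_x=\{\tilde\xi_x:\xi\in\mathfrak g\}$ for $x\in M$. Suppose that $\Phi$ is strongly presymplectic: $\Phi_g^*\Omega=\Omega$ for all $g\in G$, and $i(\tilde\xi)\Omega$ is exact for every $\xi\in\mathfrak g$. Let $J\colon M\to\mathfrak g^*$ be a momentum map of the action, that is, $J(x)(\xi)=f_\xi(x)$ where $\xi\mapsto f_\xi\in C^\infty(M)$ is linear and $i(\tilde\xi)\Omega=df_\xi$. Let $\mu\in\mathfrak g^*$ be a weakly regular value of $J$: $J^{-1}(\mu)$ is an embedded submanifold of $M$ and $T_x(J^{-1}(\mu))=\ker T_xJ$ for every $x\in J^{-1}(\mu)$. A connected integral submanifold of the Pfaff system $i(\tilde\xi)\Omega=0$ $(\xi\in\mathfrak g)$ is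 the image of a (nonempty) connected second countable manifold $N$ under an injective immersion $\iota\colon N\to M$ with $\iota^*(i(\tilde\xi)\Omega)=0$ for all $\xi\in\mathfrak g$; it is maximal if it is not properly contained in another one. Then: 1. The connected components of $J^{-1}(\mu)$ are exactly the maximal connected integral submanifolds of the Pfaff system $i(\tilde\xi)\Omega=0$, $\xi\in\mathfrak g$, that meet $J^{-1}(\mu)$. 2. For every $x\in J^{-1}(\mu)$, $T_x(J^{-1}(\mu))=\tilde{\mathfrak g}_x^{\perp}:=\{v\in T_xM:\Omega_x(w,v)=0\text{ for all }w\in\tilde{\mathfrak g}_x\}$. Consequently $\ker\Omega_x\subseteq T_x(J^{-1}(\mu))$, and every smooth vector field $Z$ on $M$ with $i(Z)\Omega=0$ is tangent to $J^{-1}(\mu)$ at all points of $J^{-1}(\mu)$. -/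

import Mathlib

open Set Topology Bundle
open scoped Manifold ContDiff

noncomputable section

namespace Presymplectic

universe u

section Forms

variable {E : Type*} [NormedAddCommGroup E] [NormedSpace ℝ E]

/-- Fields of bilinear forms on the tangent spaces of `M`; the 2-forms are the smooth alternating
ones. -/
abbrev BilinField (E : Type*) [NormedAddCommGroup E] [NormedSpace ℝ E]
    (M : Type*) [TopologicalSpace M] [ChartedSpace E M] : Type _ :=
  ∀ x : M, TangentSpace 𝓘(ℝ, E) x →L[ℝ] TangentSpace 𝓘(ℝ, E) x →L[ℝ] ℝ

/-- Fields of linear forms on the tangent spaces of `M`. -/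
abbrev CovectorField (E : Type*) [NormedAddCommGroup E] [NormedSpace ℝ E]
    (M : Type*) [TopologicalSpace M] [ChartedSpace E M] : Type _ :=
  ∀ x : M, TangentSpace 𝓘(ℝ, E) x →L[ℝ] ℝ

/-- Fields of tangent vectors (no regularity). -/
abbrev VField (E : Type*) [NormedAddCommGroup E] [NormedSpace ℝ E]
    (M : Type*) [TopologicalSpace M] [ChartedSpace E M] : Type _ :=
  ∀ x : M, TangentSpace 𝓘(ℝ, E) x

variable {M : Type*} [TopologicalSpace M] [ChartedSpace E M]

/-- `X` is a smooth vector field on `M`. -/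
def IsSmoothVField [IsManifold 𝓘(ℝ, E) ∞ M] (X : VField E M) : Prop :=
  ContMDiff 𝓘(ℝ, E) 𝓘(ℝ, E).tangent ∞ (fun x => (⟨x, X x⟩ : TangentBundle 𝓘(ℝ, E) M))

/-- The differential of a real function, as a field of linear forms. -/
def diff (f : M → ℝ) : CovectorField E M := fun x => mfderiv 𝓘(ℝ, E) 𝓘(ℝ, ℝ) f x

/-- The contraction `i(X)Ω = Ω(X, ·)`. -/
def contract (X : VField E M) (Ω : BilinField E M) : CovectorField E M := fun x => Ω x (X x)

/-- The value `dΩ(X, Y, Z)` of the exterior derivative on vector fields, by the invariant formula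
`X(Ω(Y,Z)) - Y(Ω(X,Z)) + Z(Ω(X,Y)) - Ω([X,Y],Z) + Ω([X,Z],Y) - Ω([Y,Z],X)`. -/
def extDerivOn (Ω : BilinField E M) (X Y Z : VField E M) (x : M) : ℝ :=
  diff (fun y => Ω y (Y y) (Z y)) x (X x) - diff (fun y => Ω y (X y) (Z y)) x (Y x)
    + diff (fun y => Ω y (X y) (Y y)) x (Z x)
    - Ω x (VectorField.mlieBracket 𝓘(ℝ, E) X Y x) (Z x)
    + Ω x (VectorField.mlieBracket 𝓘(ℝ, E) X Z x) (Y x)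
    - Ω x (VectorField.mlieBracket 𝓘(ℝ, E) Y Z x) (X x)

/-- `Ω` is a presymplectic form: a smooth closed 2-form of constant rank. (The nondegenerate case
is not excluded.) -/
structure IsPresymplecticForm [IsManifold 𝓘(ℝ, E) ∞ M] (Ω : BilinField E M) : Prop where
  smooth : ContMDiff 𝓘(ℝ, E) (𝓘(ℝ, E).prod 𝓘(ℝ, E →L[ℝ] E →L[ℝ] ℝ)) ∞
    (fun x => TotalSpace.mk' (E →L[ℝ] E →L[ℝ] ℝ)
      (E := fun x : M => TangentSpace 𝓘(ℝ, E) x →L[ℝ] TangentSpace 𝓘(ℝ, E) x →L[ℝ] ℝ) x (Ω x))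
  alternating : ∀ (x : M) (v : TangentSpace 𝓘(ℝ, E) x), Ω x v v = 0
  closed : ∀ X Y Z : VField E M, IsSmoothVField X → IsSmoothVField Y → IsSmoothVField Z →
    ∀ x, extDerivOn Ω X Y Z x = 0
  constant_rank : ∃ r : ℕ, ∀ x : M, Module.finrank ℝ (LinearMap.range (Ω x).toLinearMap) = r

/-- The kernel of the linear map `v ↦ Ω x v`. -/
def kerAt (Ω : BilinField E M) (x : M) : Submodule ℝ (TangentSpace 𝓘(ℝ, E) x) :=
  LinearMap.ker (Ω x).toLinearMap

/-- The module `ker Ω` of the smooth vector fields `Z` with `i(Z)Ω = 0`. -/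
def kerFields [IsManifold 𝓘(ℝ, E) ∞ M] (Ω : BilinField E M) : Set (VField E M) :=
  {Z | IsSmoothVField Z ∧ contract Z Ω = 0}

/-- The `Ω`-orthogonal `{v | Ω(w, v) = 0 for all w ∈ W}` of a set of tangent vectors at `x`. -/
def orthogonal (Ω : BilinField E M) (x : M) (W : Set (TangentSpace 𝓘(ℝ, E) x)) :
    Submodule ℝ (TangentSpace 𝓘(ℝ, E) x) where
  carrier := {v | ∀ w ∈ W, Ω x w v = 0}
  add_mem' := by
    intro a b ha hb w hw
    rw [map_add, ha w hw, hb w hw, add_zero]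
  zero_mem' := by
    intro w _
    exact map_zero _
  smul_mem' := by
    intro c a ha w hw
    rw [map_smul, ha w hw, smul_zero]

end Forms

section Submanifolds

variable {E : Type*} [NormedAddCommGroup E] [NormedSpace ℝ E]
  {M : Type u} [TopologicalSpace M] [ChartedSpace E M]

/-- The structure of an embedded smooth submanifold on a subset `S` of `M`. -/
structure EmbeddedSubmanifold (E : Type*) [NormedAddCommGroup E] [NormedSpace ℝ E]
    {M : Type u} [TopologicalSpace M] [ChartedSpace E M] (S : Set M) where
  dim : ℕ
  charted : ChartedSpace (EuclideanSpace ℝ (Fin dim)) S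
  isManifold : IsManifold (𝓡 dim) ∞ S
  isSmoothEmbedding :
    Manifold.IsSmoothEmbedding (𝓡 dim) 𝓘(ℝ, E) ∞ (Subtype.val : S → M)

/-- The tangent space of an embedded submanifold, as a subspace of the tangent space of `M`. -/
def EmbeddedSubmanifold.tangentSpace {S : Set M} (L : EmbeddedSubmanifold E S) (x : S) :
    Submodule ℝ (TangentSpace 𝓘(ℝ, E) (x : M)) :=
  letI := L.charted
  LinearMap.range (mfderiv (𝓡 L.dim) 𝓘(ℝ, E) (Subtype.val : S → M) x).toLinearMap

/-- `S` is a connected integral submanifold of the Pfaff system `α = 0`, `α ∈ P`: the image of a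
connected manifold `N` (second countable, of any dimension) under an injective immersion `i` with
`i^* α = 0` for all `α ∈ P`. -/
def IsConnectedIntegralSubmanifold (P : Set (CovectorField E M)) (S : Set M) : Prop :=
  ∃ (k : ℕ) (N : Type u) (_ : TopologicalSpace N)
    (_ : ChartedSpace (EuclideanSpace ℝ (Fin k)) N) (_ : IsManifold (𝓡 k) ∞ N)
    (_ : T2Space N) (_ : SecondCountableTopology N) (_ : ConnectedSpace N) (i : N → M),
    Function.Injective i ∧ Manifold.IsImmersion (𝓡 k) 𝓘(ℝ, E) ∞ i ∧ range i = S ∧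
      ∀ α ∈ P, ∀ (y : N) (v : TangentSpace (𝓡 k) y),
        α (i y) (mfderiv (𝓡 k) 𝓘(ℝ, E) i y v) = 0

/-- The connected integral submanifolds that are maximal with respect to inclusion. -/
def IsMaximalConnectedIntegralSubmanifold (P : Set (CovectorField E M)) (S : Set M) : Prop :=
  Maximal (IsConnectedIntegralSubmanifold P) S

end Submanifolds

section Actions

variable {E : Type*} [NormedAddCommGroup E] [NormedSpace ℝ E]
  {M : Type u} [TopologicalSpace M] [ChartedSpace E M]
  (F : Type*) [NormedAddCommGroup F] [NormedSpace ℝ F]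
  (G : Type*) [TopologicalSpace G] [ChartedSpace F G] [Group G] [MulAction G M]

/-- The fundamental vector field `ξ̃` of `ξ ∈ 𝔤 = T₁G`: its value at `x` is the image of `ξ` under
the derivative at `1` of the orbit map `g ↦ g • x`. -/
def fundamentalField (ξ : GroupLieAlgebra 𝓘(ℝ, F) G) : VField E M := fun x =>
  mfderiv 𝓘(ℝ, F) 𝓘(ℝ, E) (fun g : G => g • x) 1 ξ

/-- The values at `x` of the fundamental vector fields. -/
def fundamentalVectorsAt (x : M) : Set (TangentSpace 𝓘(ℝ, E) x) :=
  range (fun ξ : GroupLieAlgebra 𝓘(ℝ, F) G => fundamentalField (E := E) (M := M) F G ξ x)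

/-- Every `g ∈ G` preserves `Ω`, that is `Φ_g^* Ω = Ω`. -/
def IsPresymplecticAction (Ω : BilinField E M) : Prop :=
  ∀ (g : G) (x : M) (v w : TangentSpace 𝓘(ℝ, E) x),
    Ω (g • x) (mfderiv 𝓘(ℝ, E) 𝓘(ℝ, E) (fun y : M => g • y) x v)
      (mfderiv 𝓘(ℝ, E) 𝓘(ℝ, E) (fun y : M => g • y) x w) = Ω x v w

/-- A presymplectic action such that `i(ξ̃)Ω` is exact for all `ξ ∈ 𝔤`. -/
def IsStronglyPresymplecticAction (Ω : BilinField E M) : Prop :=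
  IsPresymplecticAction G Ω ∧
    ∀ ξ : GroupLieAlgebra 𝓘(ℝ, F) G, ∃ f : M → ℝ, ContMDiff 𝓘(ℝ, E) 𝓘(ℝ, ℝ) ∞ f ∧
      contract (fundamentalField F G ξ) Ω = diff f

/-- A comomentum mapping: a linear map `ξ ↦ f_ξ` with `i(ξ̃)Ω = d f_ξ`. -/
def IsComomentumMap (Ω : BilinField E M)
    (Jstar : GroupLieAlgebra 𝓘(ℝ, F) G →ₗ[ℝ] C^∞⟮𝓘(ℝ, E), M; 𝓘(ℝ, ℝ), ℝ⟯) : Prop :=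
  ∀ ξ : GroupLieAlgebra 𝓘(ℝ, F) G, contract (fundamentalField F G ξ) Ω = diff (Jstar ξ)

/-- A momentum mapping `J : M → 𝔤*`, dual to a comomentum mapping: `J(x)(ξ) = f_ξ(x)`. As a vector
space `𝔤 = T₁G` is the model space `F` of `G`; writing the dual as `F →L[ℝ] ℝ` provides its
norm. -/
def IsMomentumMap (Ω : BilinField E M) (J : M → (F →L[ℝ] ℝ)) : Prop :=
  ∃ Jstar : GroupLieAlgebra 𝓘(ℝ, F) G →ₗ[ℝ] C^∞⟮𝓘(ℝ, E), M; 𝓘(ℝ, ℝ), ℝ⟯,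
    IsComomentumMap F G Ω Jstar ∧
      ∀ (x : M) (ξ : GroupLieAlgebra 𝓘(ℝ, F) G), J x ξ = Jstar ξ x

/-- The Pfaff system `i(ξ̃)Ω = 0`, `ξ ∈ 𝔤`. -/
def pfaffSystem (Ω : BilinField E M) : Set (CovectorField E M) :=
  range (fun ξ : GroupLieAlgebra 𝓘(ℝ, F) G => contract (fundamentalField F G ξ) Ω)

end Actions

/-- `μ` is a weakly regular value of `J`: the level set is an embedded submanifold whose tangent
space at each of its points `x` is the kernel of `T_x J`. -/
def IsWeaklyRegularValue {E : Type*} [NormedAddCommGroup E] [NormedSpace ℝ E]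
    {M : Type u} [TopologicalSpace M] [ChartedSpace E M]
    {V : Type*} [NormedAddCommGroup V] [NormedSpace ℝ V] (J : M → V) (μ : V) : Prop :=
  ∃ L : EmbeddedSubmanifold E (J ⁻¹' {μ}), ∀ x : (J ⁻¹' {μ} : Set M),
    L.tangentSpace x = LinearMap.ker (mfderiv 𝓘(ℝ, E) 𝓘(ℝ, V) J (x : M)).toLinearMap

end Presymplectic

end

open Presymplectic Manifold

namespace Presymplectic

/-! Differentiating `J(x)(ξ) = f_ξ(x)` gives `(T_x J v)(ξ) = Ω(ξ̃, v)`, which is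
`IsMomentumMap.mfderiv_apply`. Hence `ker T_x J` is the orthogonal of the fundamental vectors, and
an immersion `i` solves the Pfaff system exactly when `d(J ∘ i) = 0`. So `J` is constant on a
connected integral submanifold (`IsMomentumMap.subset_fiber`): one that meets `J⁻¹(μ)` lies in a
single component of it. Conversely, weak regularity makes the tangent spaces of `J⁻¹(μ)` equal to
`ker T_x J`, so each component is itself integral, and therefore the largest integral submanifold
through its points. Weak regularity supplies one submanifold structure on the level set;
`EmbeddedSubmanifold.tangentSpace_le` carries its tangent spaces over to any other. -/

/-- The restriction of a chart in the maximal atlas to an open subset `s` lies in the maximal atlas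
of `s`. -/
theorem subtypeRestr_mem_maximalAtlas_of_mem {H N : Type*} [TopologicalSpace H] [TopologicalSpace N]
    [ChartedSpace H N] {G : StructureGroupoid H} [HasGroupoid N G] [ClosedUnderRestriction G]
    {e : OpenPartialHomeomorph N H} (he : e ∈ G.maximalAtlas N) {s : TopologicalSpace.Opens N}
    (hs : Nonempty s) : e.subtypeRestr hs ∈ G.maximalAtlas s := by
  -- Up to equality on sources, a transition map between restricted charts is an open restriction of
  -- the original transition map.
  have key : ∀ e₁ ∈ G.maximalAtlas N, ∀ e₂ ∈ G.maximalAtlas N,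
      (e₁.subtypeRestr hs).symm ≫ₕ e₂.subtypeRestr hs ∈ G := fun e₁ h₁ e₂ h₂ =>
    G.mem_of_eqOnSource
      (closedUnderRestriction' (G.compatible_of_mem_maximalAtlas h₁ h₂)
        (e₁.isOpen_inter_preimage_symm s.2))
      (e₁.subtypeRestr_symm_trans_subtypeRestr hs e₂)
  intro e' he'
  obtain ⟨x, rfl⟩ := TopologicalSpace.Opens.chart_eq hs he'
  have hx := G.chart_mem_maximalAtlas (x : N)
  exact ⟨key _ he _ hx, key _ hx _ he⟩

/-! ### Functions with zero differential -/

section Calculus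

variable {E₁ : Type*} [NormedAddCommGroup E₁] [NormedSpace ℝ E₁]
  {N : Type*} [TopologicalSpace N] [ChartedSpace E₁ N] [IsManifold 𝓘(ℝ, E₁) ∞ N]
  {V : Type*} [NormedAddCommGroup V] [NormedSpace ℝ V]

/-- A differentiable function on a manifold with vanishing derivative is locally constant. -/
theorem isLocallyConstant_of_mfderiv_eq_zero {f : N → V}
    (hf : MDifferentiable 𝓘(ℝ, E₁) 𝓘(ℝ, V) f)
    (h0 : ∀ y, mfderiv 𝓘(ℝ, E₁) 𝓘(ℝ, V) f y = 0) : IsLocallyConstant f := by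
  refine (IsLocallyConstant.iff_eventually_eq f).2 fun x => ?_
  let φ := chartAt E₁ x
  have hD : ∀ z ∈ φ.target, HasFDerivAt (f ∘ φ.symm) (0 : E₁ →L[ℝ] V) z := by
    intro z hz
    have h1 : MDifferentiableAt 𝓘(ℝ, E₁) 𝓘(ℝ, E₁) φ.symm z :=
      ((contMDiffOn_chart_symm (I := 𝓘(ℝ, E₁)) (n := ∞) (x := x)).contMDiffAt
        (φ.open_target.mem_nhds hz)).mdifferentiableAt (by simp)
    have h2 := (hf (φ.symm z)).hasMFDerivAt.comp z h1.hasMFDerivAt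
    rw [h0] at h2
    have h3 := h2.hasFDerivAt
    convert! h3 using 1
  -- In the chart the derivative vanishes on an open set, so the level set of the value `f x` is
  -- open there.
  have hopen := φ.open_target.isOpen_inter_preimage_of_fderiv_eq_zero (f := f ∘ φ.symm) (𝕜 := ℝ)
    (fun z hz => (hD z hz).differentiableAt.differentiableWithinAt)
    (fun z hz => (hD z hz).fderiv) {f x}
  have hx : x ∈ φ.source := mem_chart_source E₁ x
  have hnhds : φ.target ∩ (f ∘ φ.symm) ⁻¹' {f x} ∈ 𝓝 (φ x) :=
    hopen.mem_nhds ⟨φ.map_source hx, by simp [φ.left_inv hx]⟩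
  filter_upwards [φ.continuousAt hx hnhds, φ.open_source.mem_nhds hx] with y hy hys
  simpa [φ.left_inv hys] using hy.2

end Calculus

/-! ### Immersions and independence of the tangent spaces -/

section Immersions

variable {E : Type*} [NormedAddCommGroup E] [NormedSpace ℝ E]
  {M : Type*} [TopologicalSpace M] [ChartedSpace E M]
  {E₁ : Type*} [NormedAddCommGroup E₁] [NormedSpace ℝ E₁]
  {N₁ : Type*} [TopologicalSpace N₁] [ChartedSpace E₁ N₁]
  {E₂ : Type*} [NormedAddCommGroup E₂] [NormedSpace ℝ E₂]
  {N₂ : Type*} [TopologicalSpace N₂] [ChartedSpace E₂ N₂]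

/-- The restriction of an immersion to an open subset is an immersion. -/
theorem isImmersion_comp_opens_val [IsManifold 𝓘(ℝ, E₁) ∞ N₁]
    {φ : N₁ → M} (hφ : IsImmersion 𝓘(ℝ, E₁) 𝓘(ℝ, E) ∞ φ)
    (U : TopologicalSpace.Opens N₁) :
    IsImmersion 𝓘(ℝ, E₁) 𝓘(ℝ, E) ∞ (φ ∘ (Subtype.val : U → N₁)) := by
  obtain ⟨C, _, _, hC⟩ := hφ
  refine ⟨C, inferInstance, inferInstance, fun y => ?_⟩
  have h := hC y.1
  -- The local normal form of `φ` is kept: only the domain chart shrinks.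
  refine IsImmersionAtOfComplement.mk_of_charts h.equiv (h.domChart.subtypeRestr ⟨y⟩) h.codChart
    ?_ h.mem_codChart_source ?_ h.codChart_mem_maximalAtlas ?_ ?_
  · rw [OpenPartialHomeomorph.subtypeRestr_source]
    exact h.mem_domChart_source
  · exact subtypeRestr_mem_maximalAtlas_of_mem h.domChart_mem_maximalAtlas ⟨y⟩
  · rw [OpenPartialHomeomorph.subtypeRestr_source]
    exact fun z hz => h.source_subset_preimage_source hz
  · intro z hz
    have hz' : z ∈ (h.domChart.subtypeRestr ⟨y⟩).target := by simpa using hz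
    have hzt : z ∈ (h.domChart.extend 𝓘(ℝ, E₁)).target := by
      simpa using OpenPartialHomeomorph.subtypeRestr_target_subset _ ⟨y⟩ hz'
    rw [← h.writtenInCharts hzt]
    have hs := OpenPartialHomeomorph.subtypeRestr_symm_apply h.domChart ⟨y⟩ hz'
    simp only [Function.comp_apply] at hs
    simp [hs]

/-- A smooth map which factors continuously through an immersion has its tangent spaces contained
in those of the immersion. -/
theorem range_mfderiv_le_of_comp_eq {φ₁ : N₁ → M} {φ₂ : N₂ → M} {f : N₁ → N₂}
    (h₁ : ContMDiff 𝓘(ℝ, E₁) 𝓘(ℝ, E) ∞ φ₁) (h₂ : IsImmersion 𝓘(ℝ, E₂) 𝓘(ℝ, E) ∞ φ₂)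
    (hf : Continuous f) (hcomp : φ₂ ∘ f = φ₁) (x : N₁) (v : TangentSpace 𝓘(ℝ, E₁) x) :
    ∃ w : TangentSpace 𝓘(ℝ, E₂) (f x),
      (mfderiv 𝓘(ℝ, E₂) 𝓘(ℝ, E) φ₂ (f x) w : E) = mfderiv 𝓘(ℝ, E₁) 𝓘(ℝ, E) φ₁ x v := by
  subst hcomp
  -- A continuous factor through an immersion inherits smoothness from the composite, so the chain
  -- rule applies.
  have hfs : ContMDiff 𝓘(ℝ, E₁) 𝓘(ℝ, E₂) ∞ f := (ContMDiff.iff_comp_isImmersion h₂).2 ⟨hf, h₁⟩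
  refine ⟨mfderiv 𝓘(ℝ, E₁) 𝓘(ℝ, E₂) f x v, ?_⟩
  rw [mfderiv_comp x (h₂.contMDiff.mdifferentiableAt (by simp)) (hfs.mdifferentiableAt (by simp))]
  rfl

/-- The tangent spaces of an embedded submanifold do not depend on its charts. -/
theorem EmbeddedSubmanifold.tangentSpace_le {S : Set M}
    (L₁ L₂ : EmbeddedSubmanifold E S) (x : S) : L₁.tangentSpace x ≤ L₂.tangentSpace x := by
  rintro _ ⟨v, rfl⟩
  have h₁ := (letI := L₁.charted; L₁.isSmoothEmbedding.contMDiff)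
  have h₂ := (letI := L₂.charted; L₂.isSmoothEmbedding.isImmersion)
  -- `S` carries two atlases over the same subspace topology, so the identity is continuous between
  -- them.
  obtain ⟨w, hw⟩ := @range_mfderiv_le_of_comp_eq E _ _ M _ _ _ _ _ S _ L₁.charted
    _ _ _ S _ L₂.charted Subtype.val Subtype.val id h₁ h₂ continuous_id rfl x v
  exact ⟨w, hw⟩

end Immersions

/-! ### Derivative and fibres of a momentum map -/

section Momentum

variable {E : Type*} [NormedAddCommGroup E] [NormedSpace ℝ E]
  {M : Type*} [TopologicalSpace M] [ChartedSpace E M]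
  {F : Type*} [NormedAddCommGroup F] [NormedSpace ℝ F]
  {G : Type*} [TopologicalSpace G] [ChartedSpace F G] [Group G] [MulAction G M]
  {Ω : BilinField E M} {J : M → (F →L[ℝ] ℝ)}

/-- A momentum map is smooth. -/
theorem IsMomentumMap.contMDiff [FiniteDimensional ℝ F] (hJ : IsMomentumMap F G Ω J) :
    ContMDiff 𝓘(ℝ, E) 𝓘(ℝ, F →L[ℝ] ℝ) ∞ J := by
  obtain ⟨Jstar, -, hval⟩ := hJ
  let b := Module.finBasis ℝ F
  -- Expansion in the dual basis: the coefficients are the smooth functions `f_ξ` for `ξ` in a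
  -- basis.
  have hsum : J = fun x => ∑ i, Jstar (b i) x • (b.coord i).toContinuousLinearMap := by
    funext x
    refine ContinuousLinearMap.coe_injective (b.ext fun j => ?_)
    have := hval x (b j)
    simp [Finsupp.single_apply, this]
  rw [hsum]
  exact contMDiff_finsetSum fun i _ => (Jstar (b i)).contMDiff.smul contMDiff_const

/-- The derivative of a momentum map: `(T_x J v)(ξ) = Ω(ξ̃, v)`. -/
theorem IsMomentumMap.mfderiv_apply [FiniteDimensional ℝ F] (hJ : IsMomentumMap F G Ω J) (x : M)
    (v : TangentSpace 𝓘(ℝ, E) x) (ξ : F) :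
    (show F →L[ℝ] ℝ from mfderiv 𝓘(ℝ, E) 𝓘(ℝ, F →L[ℝ] ℝ) J x v) ξ =
      Ω x (fundamentalField F G ξ x) v := by
  have hd := (hJ.contMDiff.mdifferentiableAt (x := x) (by simp)).hasMFDerivAt
  obtain ⟨Jstar, hcom, hval⟩ := hJ
  have h1 := ((ContinuousLinearMap.apply ℝ ℝ ξ).hasMFDerivAt (x := J x)).comp x hd
  -- Evaluation at `ξ` is linear and turns `J` into `f_ξ`, whose differential is `i(ξ̃)Ω`.
  have h2 : (ContinuousLinearMap.apply ℝ ℝ ξ : (F →L[ℝ] ℝ) → ℝ) ∘ J = Jstar ξ :=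
    funext fun y => hval y ξ
  rw [h2] at h1
  have h3 := congrFun (hcom ξ) x
  change Ω x (fundamentalField F G ξ x) = mfderiv 𝓘(ℝ, E) 𝓘(ℝ, ℝ) (Jstar ξ) x at h3
  rw [h3, h1.mfderiv]
  rfl

/-- The kernel of the derivative of a momentum map is the orthogonal of the tangent spaces to the
orbits. -/
theorem IsMomentumMap.ker_mfderiv [FiniteDimensional ℝ F] (hJ : IsMomentumMap F G Ω J) (x : M) :
    LinearMap.ker (mfderiv 𝓘(ℝ, E) 𝓘(ℝ, F →L[ℝ] ℝ) J x).toLinearMap =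
      orthogonal Ω x (fundamentalVectorsAt F G x) := by
  ext v
  constructor
  · rintro hv _ ⟨ξ, rfl⟩
    have hv' : (show F →L[ℝ] ℝ from mfderiv 𝓘(ℝ, E) 𝓘(ℝ, F →L[ℝ] ℝ) J x v) = 0 := hv
    change Ω x (fundamentalField F G ξ x) v = 0
    rw [← hJ.mfderiv_apply x v ξ, hv']
    rfl
  · intro hv
    refine LinearMap.mem_ker.2 (ContinuousLinearMap.ext fun ξ => ?_)
    exact (hJ.mfderiv_apply x v ξ).trans (hv _ ⟨ξ, rfl⟩)

/-- A momentum map is constant along connected integral submanifolds of the Pfaff system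
`i(ξ̃)Ω = 0`. -/
theorem IsMomentumMap.subset_fiber [FiniteDimensional ℝ F] (hJ : IsMomentumMap F G Ω J)
    {S : Set M} (hS : IsConnectedIntegralSubmanifold (pfaffSystem F G Ω) S) {x : M} (hx : x ∈ S) :
    S ⊆ J ⁻¹' {J x} := by
  obtain ⟨k, N, _, _, _, _, _, _, i, -, himm, rfl, hint⟩ := hS
  have hi : MDifferentiable (𝓡 k) 𝓘(ℝ, E) i := himm.contMDiff.mdifferentiable (by simp)
  have hJd : MDifferentiable 𝓘(ℝ, E) 𝓘(ℝ, F →L[ℝ] ℝ) J := hJ.contMDiff.mdifferentiable (by simp)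
  have hconst : IsLocallyConstant (J ∘ i) := by
    refine isLocallyConstant_of_mfderiv_eq_zero (hJd.comp hi) fun y => ?_
    rw [mfderiv_comp y (hJd _) (hi y)]
    refine ContinuousLinearMap.ext fun v => ContinuousLinearMap.ext fun ξ => ?_
    exact (hJ.mfderiv_apply (i y) _ ξ).trans (hint _ ⟨ξ, rfl⟩ y v)
  obtain ⟨y, rfl⟩ := hx
  rintro _ ⟨z, rfl⟩
  exact hconst.apply_eq_of_isPreconnected isPreconnected_univ (mem_univ z) (mem_univ y)

end Momentum

/-! ### Components of a submanifold as integral submanifolds -/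

section Integral

variable {E : Type*} [NormedAddCommGroup E] [NormedSpace ℝ E]
  {M : Type u} [TopologicalSpace M] [ChartedSpace E M]

/-- A connected integral submanifold is connected as a subset. -/
theorem IsConnectedIntegralSubmanifold.isConnected {P : Set (CovectorField E M)} {S : Set M}
    (hS : IsConnectedIntegralSubmanifold P S) : IsConnected S := by
  obtain ⟨k, N, _, _, _, _, _, _, i, -, himm, rfl, -⟩ := hS
  exact isConnected_range himm.contMDiff.continuous

/-- If the forms in `P` vanish on the tangent spaces of an embedded submanifold, then its connected
components are integral submanifolds of `P`. -/
theorem EmbeddedSubmanifold.isConnectedIntegralSubmanifold_connectedComponentIn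
    [T2Space M] [SecondCountableTopology M] {S : Set M} (L : EmbeddedSubmanifold E S)
    {P : Set (CovectorField E M)}
    (hP : ∀ α ∈ P, ∀ (x : S), ∀ v ∈ L.tangentSpace x, α x v = 0) {x : M} (hx : x ∈ S) :
    IsConnectedIntegralSubmanifold P (connectedComponentIn S x) := by
  let := L.charted
  have := L.isManifold
  -- Local connectedness makes the component open in `S`, hence a manifold of the same dimension.
  have : LocallyConnectedSpace S :=
    ChartedSpace.locallyConnectedSpace (EuclideanSpace ℝ (Fin L.dim)) S
  let U : TopologicalSpace.Opens S :=
    ⟨connectedComponent (⟨x, hx⟩ : S), isOpen_connectedComponent⟩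
  have himm : IsImmersion (𝓡 L.dim) 𝓘(ℝ, E) ∞ ((Subtype.val : S → M) ∘ (Subtype.val : U → S)) :=
    isImmersion_comp_opens_val L.isSmoothEmbedding.isImmersion U
  refine ⟨L.dim, U, inferInstance, inferInstance, inferInstance, inferInstance, inferInstance,
    isConnected_iff_connectedSpace.1 isConnected_connectedComponent, _,
    Subtype.val_injective.comp Subtype.val_injective, himm, ?_, fun α hα y v => ?_⟩
  · rw [range_comp, connectedComponentIn_eq_image hx]
    congr 1
    exact Subtype.range_val
  · obtain ⟨w, hw⟩ := range_mfderiv_le_of_comp_eq himm.contMDiff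
      L.isSmoothEmbedding.isImmersion continuous_subtype_val rfl y v
    exact hP α hα y.1 _ ⟨w, hw⟩

end Integral

end Presymplectic

theorem mainTheorem7
    {E : Type*} [NormedAddCommGroup E] [NormedSpace ℝ E] [FiniteDimensional ℝ E]
    {M : Type*} [TopologicalSpace M] [T2Space M] [SecondCountableTopology M]
    [ChartedSpace E M] [IsManifold 𝓘(ℝ, E) ∞ M]
    {F : Type*} [NormedAddCommGroup F] [NormedSpace ℝ F] [FiniteDimensional ℝ F]
    {G : Type*} [TopologicalSpace G] [ChartedSpace F G] [Group G] [LieGroup 𝓘(ℝ, F) ∞ G]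
    [MulAction G M] [ContMDiffSMul 𝓘(ℝ, F) 𝓘(ℝ, E) ∞ G M]
    (Ω : Presymplectic.BilinField E M) (hΩ : Presymplectic.IsPresymplecticForm Ω)
    (hΦ : Presymplectic.IsStronglyPresymplecticAction F G Ω)
    (J : M → (F →L[ℝ] ℝ)) (hJ : Presymplectic.IsMomentumMap F G Ω J)
    (μ : F →L[ℝ] ℝ) (hμ : Presymplectic.IsWeaklyRegularValue (E := E) J μ) :
    (∀ S : Set M,
      (∃ x ∈ J ⁻¹' {μ}, S = connectedComponentIn (J ⁻¹' {μ}) x) ↔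
        (Presymplectic.IsMaximalConnectedIntegralSubmanifold
            (Presymplectic.pfaffSystem F G Ω) S ∧ (S ∩ J ⁻¹' {μ}).Nonempty)) ∧
    ∀ L : Presymplectic.EmbeddedSubmanifold E (J ⁻¹' {μ}),
      (∀ x : (J ⁻¹' {μ} : Set M), L.tangentSpace x =
        Presymplectic.orthogonal Ω x (Presymplectic.fundamentalVectorsAt F G (x : M))) ∧
      (∀ x : (J ⁻¹' {μ} : Set M), Presymplectic.kerAt Ω (x : M) ≤ L.tangentSpace x) ∧
      (∀ Z ∈ Presymplectic.kerFields Ω, ∀ x : (J ⁻¹' {μ} : Set M),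
        Z x ∈ L.tangentSpace x) := by
  obtain ⟨L₀, hL₀⟩ := hμ
  have htan : ∀ (L : EmbeddedSubmanifold E (J ⁻¹' {μ})) (x : (J ⁻¹' {μ} : Set M)),
      L.tangentSpace x = orthogonal Ω x (fundamentalVectorsAt F G (x : M)) := fun L x => by
    rw [← hJ.ker_mfderiv (x : M), ← hL₀ x]
    exact le_antisymm (L.tangentSpace_le L₀ x) (L₀.tangentSpace_le L x)
  have hker : ∀ (L : EmbeddedSubmanifold E (J ⁻¹' {μ})) (x : (J ⁻¹' {μ} : Set M)),
      kerAt Ω (x : M) ≤ L.tangentSpace x := by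
    intro L x v hv
    rw [htan]
    intro w _
    have hvw : Ω x v = 0 := hv
    -- Polarisation: `Ω(v, w) = 0` forces `Ω(w, v) = 0`.
    have hadd := hΩ.alternating x (v + w)
    simpa [hΩ.alternating, hvw] using hadd
  have hcomp : ∀ x ∈ J ⁻¹' {μ}, IsConnectedIntegralSubmanifold (pfaffSystem F G Ω)
      (connectedComponentIn (J ⁻¹' {μ}) x) := by
    refine fun x hx => L₀.isConnectedIntegralSubmanifold_connectedComponentIn ?_ hx
    rintro _ ⟨ξ, rfl⟩ y v hv
    rw [htan] at hv
    exact hv _ ⟨ξ, rfl⟩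
  -- This containment yields both the maximality of components and the converse.
  have hsub : ∀ S : Set M, IsConnectedIntegralSubmanifold (pfaffSystem F G Ω) S →
      ∀ x ∈ S, x ∈ J ⁻¹' {μ} → S ⊆ connectedComponentIn (J ⁻¹' {μ}) x := by
    intro S hS x hxS hx
    have hfib := hJ.subset_fiber hS hxS
    rw [show J x = μ from hx] at hfib
    exact hS.isConnected.isPreconnected.subset_connectedComponentIn hxS hfib
  refine ⟨fun S => ⟨?_, ?_⟩, fun L => ⟨htan L, hker L, fun Z hZ x => ?_⟩⟩
  · rintro ⟨x, hx, rfl⟩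
    have hxC := mem_connectedComponentIn hx
    exact ⟨⟨hcomp x hx, fun T hT hle => hsub T hT x (hle hxC) hx⟩, x, hxC, hx⟩
  · rintro ⟨hmax, x, hxS, hx⟩
    have hle := hsub S hmax.prop x hxS hx
    -- The component is an integral submanifold containing `S`, so maximality of `S` forces
    -- equality.
    exact ⟨x, hx, hle.antisymm (hmax.le_of_ge (hcomp x hx) hle)⟩
  · exact hker L x (congrFun hZ.2 (x : M))
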